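/- **Setting.** Let $(E;\oplus,0,1)$ be an effect algebra: $\oplus$ is a partial, commutative and associative operation, each $a$ has a unique orthosupplement $a'$ with $a\oplus a'=1$, and $a\oplus 1$ is defined only for $a=0$. Order $E$ by $a\le b$ iff $a\oplus c=b$ for some $c$; then $b\ominus a:=c$. Elements $a,b$ are Mackey compatible, $a\leftrightarrow b$, if $a=a_1\oplus c$, $b=b_1\oplus c$ with $a_1\oplus b_1\oplus c$ defined. A compression is an additive map $J:E\to E$ such that $a\le J(1)$ implies $J(a)=a$, and $J(a)=0$ iff $a\le J(1)'$. A compression base is a family of compressions $(J_p)_{p\in P}$, indexed by a sub-effect algebra $P\subseteq E$, with $J_p(1)=p$ and such that $p,q\in P$, $p\leftrightarrow q$ imply $J_p\circ J_q=J_r$ for some $r\in P$. Fix a compression base on $E$. For $p\in P$ let $C(p)=\{a: a=J_p(a)\oplus J_{p'}(a)\}$; for $A\subseteq E$ let $PC(A)=\{p\in P: A\subseteq C(p)\}$ and $P(A)=PC(PC(A)\cup A)$; write $P(a)=P(\{a\})$, $P(a,b)=P(\{a,b\})$. Write $aCb$ if $p\leftrightarrow q$ for all $p\in P(a)$, $q\in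 P(b)$, and let $$P_\le(a,b)=\{p\in P(a,b): J_p(a)\le J_p(b),\ J_{p'}(b)\le J_{p'}(a)\}.$$ $E$ is *spectral* if * (b-comparability) for every $a\in E$ there is a Boolean subalgebra $B(a)\subseteq P$ with $a\in C(p)\Leftrightarrow B(a)\subseteq C(p)$ for all $p\in P$, and $P_\le(a,b)\neq\emptyset$ whenever $aCb$; and * (projection covers) every $a\in E$ has a projection cover $a^\circ\in P$: for all $q\in P$, $a\le q\Leftrightarrow a^\circ\le q$. In a spectral $E$, for $aCb$, put $(b-a)_+:=J_p(b)\ominus J_p(a)$, where $p\in P_\le(a,b)$ (the result does not depend on $p$). For a binary string $w=w_1\dots w_n$ let $l(w)=n$ and $\lambda(w)=\sum_{j}w_j2^{-j}$. For $a\in E$ define $u_w,c_w$ by $u_\varepsilon=a^\circ$, $c_\varepsilon=a$ for the empty string $\varepsilon$, and $$u_{w0}=\big((c_w-c_w')_+{}^{\circ}\big)'\wedge u_w,\quad u_{w1}=u_w\wedge u_{w0}',\quad c_{w0}=u_{w0}\ominus\big((c_w'-c_w)_+\wedge u_w\big),\quad c_{w1}=(c_w-c_w')_+\wedge u_w .$$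 The binary spectral resolution of $a$ is the family $(p_{a,\lambda})$, indexed by the dyadic rationals in $[0,1]$, given by $p_{a,0}=(a^\circ)'$, $p_{a,1}=1$ and $$p_{a,\lambda(w1)}=(a^\circ)'\oplus\bigoplus_{l(v)=l(w)+1,\ v\le w0}u_v$$ for every binary string $w$, where $\le$ is the lexicographic order of strings. A state is a map $s:E\to[0,1]$ with $s(1)=1$ and $s(a\oplus b)=s(a)+s(b)$ whenever $a\oplus b$ is defined. It is $\sigma$-additive if $s(\bigoplus_i a_i)=\sum_i s(a_i)$ for every sequence $(a_i)$ all of whose finite subfamilies are summable and whose orthosum $\bigoplus_i a_i$ (the supremum in $E$ of all the finite sums) exists. $E$ is archimedean if $a=0$ is the only $a\in E$ such that $na=a\oplus\dots\oplus a$ exists for all $n\in\mathbb N$. **Proposition.** Let $E$ be spectral, $a\in E$, and let $(c_w)$, $(u_w)$ be the families associated with $a$. Then for every state $s$ on $E$: 1. $s(a)=\lim_{n\to\infty}\sum_{l(w)=n}\lambda(w)\,s(u_w)$; and $s(a)=0$ if and only if $s(u_w)=0$ for all binary strings $w$ with $\lambda(w)\neq0$. 2. If $E$ is archimedean and $s$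 is $\sigma$-additive, then $s(a)=0$ if and only if $s(a^\circ)=0$. 3. If $b\in E$ is such that $p_{a,\lambda(w)}=p_{b,\lambda(w)}$ for all binary strings $w$, then $s(a)=s(b)$. -/

import Mathlib

/-- An effect algebra. The partial operation is modelled by `oplus : E → E → Option E`:
`oplus a b = some c` says that `a ⊕ b` is defined and equal to `c`,
`oplus a b = none` says that it is undefined. -/
class EffectAlgebra (E : Type*) extends Zero E, One E where
  oplus : E → E → Option E
  oplus_comm : ∀ a b c, oplus a b = some c → oplus b a = some c
  oplus_assoc : ∀ a b c x y, oplus a b = some x → oplus x c = some y →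
    ∃ z, oplus b c = some z ∧ oplus a z = some y
  exists_unique_ortho : ∀ a, ∃! b, oplus a b = some 1
  zero_of_oplus_one : ∀ a c, oplus a 1 = some c → a = 0

namespace EffectAlgebra

section Basic

variable {E : Type*} [EffectAlgebra E]

/-- The orthosupplement `a'` of `a`. -/
noncomputable def ortho (a : E) : E := (exists_unique_ortho a).choose

theorem oplus_ortho (a : E) : oplus a (ortho a) = some 1 :=
  (exists_unique_ortho a).choose_spec.1

theorem ortho_unique {a x y : E} (hx : oplus a x = some 1) (hy : oplus a y = some 1) : x = y :=
  (exists_unique_ortho a).unique hx hy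

theorem one_oplus_zero : oplus (1 : E) 0 = some 1 := by
  have h := oplus_ortho (1 : E)
  have h0 := zero_of_oplus_one _ _ (oplus_comm _ _ _ h)
  rwa [h0] at h

theorem oplus_zero (a : E) : oplus a 0 = some a := by
  obtain ⟨z, hz, hz'⟩ := oplus_assoc _ _ _ _ _ (oplus_comm _ _ _ (oplus_ortho a)) one_oplus_zero
  have : z = a := ortho_unique hz' (oplus_comm _ _ _ (oplus_ortho a))
  rwa [this] at hz

theorem eq_zero_of_oplus_eq_self {a z : E} (h : oplus a z = some a) : z = 0 := by
  obtain ⟨y, hy, hy'⟩ := oplus_assoc _ _ _ _ _ (oplus_comm _ _ _ h) (oplus_ortho a)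
  have : y = 1 := by
    have := oplus_ortho a
    rw [hy] at this
    exact Option.some.inj this
  subst this
  exact zero_of_oplus_one _ _ hy'

theorem eq_zero_of_oplus_eq_zero {c d : E} (h : oplus c d = some 0) : c = 0 := by
  have h' := oplus_comm _ _ _ h
  obtain ⟨y, hy, _⟩ := oplus_assoc _ _ _ _ _ h' (oplus_comm _ _ _ one_oplus_zero)
  exact zero_of_oplus_one _ _ hy

/-- The order of an effect algebra: `a ≤ b` iff `a ⊕ c = b` for some `c`. -/
instance instPartialOrder : PartialOrder E where
  le a b := ∃ c, oplus a c = some b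
  le_refl a := ⟨0, oplus_zero a⟩
  le_trans a b c := by
    rintro ⟨x, hx⟩ ⟨y, hy⟩
    obtain ⟨z, _, hz⟩ := oplus_assoc _ _ _ _ _ hx hy
    exact ⟨z, hz⟩
  le_antisymm a b := by
    rintro ⟨c, hc⟩ ⟨d, hd⟩
    obtain ⟨z, hz, hz'⟩ := oplus_assoc _ _ _ _ _ hc hd
    have h0 := eq_zero_of_oplus_eq_self hz'
    subst h0
    have h1 := eq_zero_of_oplus_eq_zero hz
    subst h1
    rw [oplus_zero] at hc
    exact Option.some.inj hc

open Classical in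
/-- The element of `E` with the property `p` (used where such an element is unique). -/
noncomputable def pick (p : E → Prop) : E := if h : ∃ x, p x then h.choose else 0

/-- The difference `b ⊖ a`, for `a ≤ b`. -/
noncomputable def ominus (b a : E) : E := pick fun c => oplus a c = some b

/-- The infimum `a ∧ b` in `E`, if it exists. -/
noncomputable def meet (a b : E) : E := pick fun m => IsGLB {a, b} m

/-- `IsSum m x`: the finite sum of the elements of `m`, with multiplicities, exists and is `x`. -/
inductive IsSum : Multiset E → E → Prop
  | zero : IsSum 0 0
  | cons (a : E) (m : Multiset E) (x y : E) :
      IsSum m x → oplus a x = some y → IsSum (a ::ₘ m) y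

/-- The finite sum of the elements of `m`, if it exists. -/
noncomputable def msum (m : Multiset E) : E := pick fun x => IsSum m x

/-- Mackey compatibility: `a = a₁ ⊕ c` and `b = b₁ ⊕ c` where `a₁ ⊕ b₁ ⊕ c` exists. -/
def Mackey (a b : E) : Prop :=
  ∃ a₁ b₁ c x y, oplus a₁ b₁ = some x ∧ oplus x c = some y ∧
    oplus a₁ c = some a ∧ oplus b₁ c = some b

variable (E) in
/-- `E` is archimedean: if `n a` exists for all `n`, then `a = 0`. -/
def IsArchimedean : Prop :=
  ∀ a : E, (∀ n : ℕ, ∃ x, IsSum (Multiset.replicate n a) x) → a = 0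

/-- Additive maps of `E` into itself. -/
def IsAdditive (J : E → E) : Prop :=
  ∀ a b c, oplus a b = some c → oplus (J a) (J b) = some (J c)

/-- Retractions. The focus of `J` is `J 1`. -/
structure IsRetraction (J : E → E) : Prop where
  additive : IsAdditive J
  eq_self : ∀ a, a ≤ J 1 → J a = a

/-- Compressions. -/
structure IsCompression (J : E → E) : Prop extends IsRetraction J where
  eq_zero_iff : ∀ a, J a = 0 ↔ a ≤ ortho (J 1)

/-- Sub-effect algebras. -/
structure IsSubEffectAlgebra (F : Set E) : Prop where
  zero_mem : (0 : E) ∈ F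
  one_mem : (1 : E) ∈ F
  ortho_mem : ∀ a ∈ F, ortho a ∈ F
  oplus_mem : ∀ a ∈ F, ∀ b ∈ F, ∀ c, oplus a b = some c → c ∈ F

/-- States: morphisms into the effect algebra `[0, 1]` of real numbers. -/
structure IsState (s : E → ℝ) : Prop where
  mem_Icc : ∀ a, s a ∈ Set.Icc (0 : ℝ) 1
  map_one : s 1 = 1
  map_oplus : ∀ a b c, oplus a b = some c → s c = s a + s b

/-- `x` is the orthosum of the sequence `f`: every finite subfamily is summable, and `x` is the
supremum in `E` of all the finite sums. -/
def IsOrthosum (f : ℕ → E) (x : E) : Prop :=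
  (∀ F : Finset ℕ, ∃ y, IsSum (F.val.map f) y) ∧
    IsLUB {y | ∃ F : Finset ℕ, IsSum (F.val.map f) y} x

/-- `σ`-additivity of a state: it maps every existing countable orthosum to the sum of the
values. -/
def IsSigmaAdditive (s : E → ℝ) : Prop :=
  ∀ (f : ℕ → E) (x : E), IsOrthosum f x → HasSum (fun i => s (f i)) (s x)

end Basic

/-- A compression base `(J p)_{p ∈ P}` on `E`. Only the maps `J p` with `p ∈ P` belong to the
family; the values of `J` at other indices are irrelevant. -/
structure CompressionBase (E : Type*) [EffectAlgebra E] where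
  P : Set E
  J : E → E → E
  isSub : IsSubEffectAlgebra P
  isCompression : ∀ p ∈ P, IsCompression (J p)
  focus : ∀ p ∈ P, J p 1 = p
  comp : ∀ p ∈ P, ∀ q ∈ P, Mackey p q → ∃ r ∈ P, J p ∘ J q = J r

namespace CompressionBase

variable {E : Type*} [EffectAlgebra E] (K : CompressionBase E)

/-- The commutant `C(p)` of a projection `p`. -/
def comm (p : E) : Set E := {a | oplus (K.J p a) (K.J (ortho p) a) = some a}

/-- `PC(A)`: the projections `p` such that `A ⊆ C(p)`. -/
def PC (A : Set E) : Set E := {p | p ∈ K.P ∧ ∀ a ∈ A, a ∈ K.comm p}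

/-- The bicommutant `P(Q) = PC(PC(Q) ∪ Q)`; moreover `P(a) = P({a})` and
`P(e, f) = P({e, f})`. -/
def bicomm (Q : Set E) : Set E := K.PC (K.PC Q ∪ Q)

/-- `B` is a Boolean subalgebra of `P`: a sub-effect algebra contained in `P` which is a Boolean
algebra in the order inherited from `E`. -/
structure IsBooleanSubalgebra (B : Set E) : Prop where
  subset : B ⊆ K.P
  isSub : IsSubEffectAlgebra B
  boolean : ∃ inst : BooleanAlgebra B, ∀ x y : B, inst.le x y ↔ (x : E) ≤ (y : E)

/-- `a` is a b-element. -/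
def IsBElement (a : E) : Prop :=
  ∃ B : Set E, K.IsBooleanSubalgebra B ∧ ∀ p ∈ K.P, a ∈ K.comm p ↔ B ⊆ K.comm p

/-- The relation `e C f`: every element of `P(e)` is Mackey compatible with every element of
`P(f)`. -/
def Commute (e f : E) : Prop :=
  ∀ p ∈ K.bicomm {e}, ∀ q ∈ K.bicomm {f}, Mackey p q

/-- The set `P_≤(e, f)`. -/
def Ple (e f : E) : Set E :=
  {p | p ∈ K.bicomm {e, f} ∧ K.J p e ≤ K.J p f ∧ K.J (ortho p) f ≤ K.J (ortho p) e}

/-- The b-comparability property. -/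
structure HasBComparability : Prop where
  b_property : ∀ a, K.IsBElement a
  nonempty : ∀ e f, K.Commute e f → (K.Ple e f).Nonempty

/-- `p` is a projection cover of `a`. -/
def IsProjCover (a p : E) : Prop := p ∈ K.P ∧ ∀ q ∈ K.P, a ≤ q ↔ p ≤ q

/-- `E` is spectral with respect to the compression base. -/
structure IsSpectral : Prop where
  bComparability : K.HasBComparability
  projCover : ∀ a, ∃ p, K.IsProjCover a p

/-- The projection cover `a°`. -/
noncomputable def cover (a : E) : E := pick fun p => K.IsProjCover a p

/-- The positive part `(b - a)_+ = J_p(b) ⊖ J_p(a)`, where `p ∈ P_≤(a, b)`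
(any such `p` gives the same element). -/
noncomputable def posPart (b a : E) : E :=
  pick fun x => ∃ p ∈ K.Ple a b, oplus (K.J p a) x = some (K.J p b)

/-- One step of the construction: from `(u_w, c_w)` to `(u_{w0}, c_{w0})` (for `false`) or to
`(u_{w1}, c_{w1})` (for `true`). -/
noncomputable def splitStep (x : E × E) (i : Bool) : E × E :=
  let u := x.1
  let c := x.2
  let u0 := meet (ortho (K.cover (K.posPart c (ortho c)))) u
  let u1 := meet u (ortho u0)
  let c0 := ominus u0 (meet (K.posPart (ortho c) c) u)
  let c1 := meet (K.posPart c (ortho c)) u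
  if i then (u1, c1) else (u0, c0)

/-- The pair `(u_w, c_w)`, starting from `(u_ε, c_ε) = (a°, a)` and reading the binary string `w`
from the left. -/
noncomputable def uc (a : E) (w : List Bool) : E × E :=
  w.foldl K.splitStep (K.cover a, a)

/-- The family `u_w` associated with `a`. -/
noncomputable def u (a : E) (w : List Bool) : E := (K.uc a w).1

/-- The family `c_w` associated with `a`. -/
noncomputable def c (a : E) (w : List Bool) : E := (K.uc a w).2

end CompressionBase

/-- `λ(w) = ∑_j w_j 2^{-j}` for a binary string `w = w_1 w_2 … w_n`. -/
def lam (w : List Bool) : ℚ :=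
  ∑ j : Fin w.length, if w.get j then (1 / 2 : ℚ) ^ ((j : ℕ) + 1) else 0

/-- The finite set of binary strings of length `n`. -/
def binStrings (n : ℕ) : Finset (List Bool) :=
  (Finset.univ : Finset (Fin n → Bool)).image List.ofFn

theorem mem_binStrings {n : ℕ} {w : List Bool} : w ∈ binStrings n ↔ w.length = n := by
  constructor
  · intro h
    obtain ⟨f, _, rfl⟩ := Finset.mem_image.1 h
    simp
  · rintro rfl
    exact Finset.mem_image.2 ⟨w.get, Finset.mem_univ _, List.ofFn_get w⟩

open Classical in
/-- The binary spectral resolution of `a`: `p_0 = (a°)'`, `p_1 = 1`, and, for a dyadic rational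
`t = λ(w1)` in `(0, 1)`, where the string `w` is determined by `t`, `p_t` is the sum of `(a°)'`
and of all `u_v` with `v` of length `l(w) + 1`, `v ≤ w0` in the lexicographical order.
The value at all other `t` is irrelevant. -/
noncomputable def CompressionBase.specProj {E : Type*} [EffectAlgebra E]
    (K : CompressionBase E) (a : E) (t : ℚ) : E :=
  if t = 0 then ortho (K.cover a)
  else if t = 1 then 1
  else if h : ∃ w : List Bool, t = lam (w ++ [true]) then
    msum (ortho (K.cover a) ::ₘ
      ((binStrings (h.choose.length + 1)).filter
        (fun v => v ≤ h.choose ++ [false])).val.map (K.u a))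
  else 0

end EffectAlgebra

/-! The construction is a binary expansion. One step splits `u` into projections `u₀` and `u₁`, the
latter being the cover `e` of `(c - c')_+`. Since `e` itself compares `c'` with `c`
(`cover_posPart_mem_Ple`), the step doubles `c` on `u₀` and gives `J_{u₁}(c) ⊖ J_{u₁}(c')`, that is
"`2c - 1`", on `u₁` (`isSplitting_splitStep`). Under a state this reads `s(c₀) + s(c₁) + s(u₁) = 2
s(c)`, and induction on length yields `s(a) = ∑ λ(w) s(u_w) + 2⁻ⁿ ∑ s(c_w)` over `l(w) = n`. As `c_w
≤ u_w` and the `s(u_w)` of one level add up to `s(a°)`, the remainder lies between 0 and `2⁻ⁿ`; this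
gives the limit and the criterion for `s(a) = 0`.

For the σ-additive part, the projections `u_{0…0}` decrease from `a°` with differences `u_{0…01}`,
on which `s` vanishes when `s(a) = 0`. A projection below all of them would allow `J_r(a)` to be
doubled forever, so in the archimedean case only 0 lies below them and `a°` is the orthosum of the
differences. Finally, the spectral projections determine every `s(u_w)` level by level, hence
`s(a)`. -/

namespace EffectAlgebra

/-! ### Arithmetic of effect algebras, finite sums and states. -/

section Algebra

variable {E : Type*} [EffectAlgebra E]

theorem oplus_assoc_right {a b c y z : E} (h : oplus b c = some z) (h' : oplus a z = some y) :
    ∃ x, oplus a b = some x ∧ oplus x c = some y := by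
  obtain ⟨x, hx, hx'⟩ := oplus_assoc _ _ _ _ _ (oplus_comm _ _ _ h) (oplus_comm _ _ _ h')
  exact ⟨x, oplus_comm _ _ _ hx, oplus_comm _ _ _ hx'⟩

/-- Both `b` and `b'` are orthosupplements of the same element `c' ⊕ a`. -/
theorem oplus_left_cancel {a b b' c : E} (h : oplus a b = some c) (h' : oplus a b' = some c) :
    b = b' := by
  have key : ∀ {d}, oplus a d = some c →
      ∃ z, oplus d (ortho c) = some z ∧ oplus a z = some 1 := fun hd =>
    oplus_assoc _ _ _ _ _ hd (oplus_ortho c)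
  obtain ⟨z, hz, hz1⟩ := key h
  obtain ⟨z', hz', hz1'⟩ := key h'
  obtain rfl := ortho_unique hz1 hz1'
  obtain ⟨t, ht, ht1⟩ := oplus_assoc _ _ _ _ _ hz (oplus_comm _ _ _ hz1)
  obtain ⟨t', ht', ht1'⟩ := oplus_assoc _ _ _ _ _ hz' (oplus_comm _ _ _ hz1)
  obtain rfl : t = t' := Option.some.inj (ht.symm.trans ht')
  exact ortho_unique (oplus_comm _ _ _ ht1) (oplus_comm _ _ _ ht1')

theorem ortho_ortho (a : E) : ortho (ortho a) = a :=
  ortho_unique (oplus_ortho _) (oplus_comm _ _ _ (oplus_ortho a))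

theorem zero_oplus (a : E) : oplus 0 a = some a := oplus_comm _ _ _ (oplus_zero a)

theorem zero_le' (a : E) : 0 ≤ a := ⟨a, zero_oplus a⟩

theorem le_one' (a : E) : a ≤ 1 := ⟨ortho a, oplus_ortho a⟩

theorem le_zero {a : E} (h : a ≤ 0) : a = 0 := le_antisymm h (zero_le' a)

theorem le_left {a b c : E} (h : oplus a b = some c) : a ≤ c := ⟨b, h⟩

theorem le_right {a b c : E} (h : oplus a b = some c) : b ≤ c := ⟨a, oplus_comm _ _ _ h⟩

theorem exists_oplus_iff {a b : E} : (∃ c, oplus a b = some c) ↔ a ≤ ortho b := by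
  constructor
  · rintro ⟨c, hc⟩
    obtain ⟨z, hz, hz'⟩ := oplus_assoc _ _ _ _ _ (oplus_comm _ _ _ hc) (oplus_ortho c)
    exact ⟨_, by rw [hz, ortho_unique hz' (oplus_ortho b)]⟩
  · rintro ⟨z, hz⟩
    obtain ⟨x, hx, -⟩ := oplus_assoc_right hz (oplus_ortho b)
    exact ⟨x, oplus_comm _ _ _ hx⟩

theorem oplus_rearrange {a b c d x y z : E} (hx : oplus a b = some x) (hy : oplus c d = some y)
    (hz : oplus x y = some z) :
    ∃ x' y', oplus a c = some x' ∧ oplus b d = some y' ∧ oplus x' y' = some z := by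
  obtain ⟨t, ht, ht'⟩ := oplus_assoc _ _ _ _ _ hx hz
  obtain ⟨r, hr, hr'⟩ := oplus_assoc_right hy ht
  obtain ⟨y', hy', hy''⟩ := oplus_assoc _ _ _ _ _ (oplus_comm _ _ _ hr) hr'
  obtain ⟨x', hx', hz'⟩ := oplus_assoc_right hy'' ht'
  exact ⟨x', y', hx', hy', hz'⟩

theorem exists_oplus_mono {a b a₁ b₁ c : E} (h : oplus a b = some c) (ha : a₁ ≤ a) (hb : b₁ ≤ b) :
    ∃ c₁, oplus a₁ b₁ = some c₁ ∧ c₁ ≤ c := by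
  obtain ⟨x, hx⟩ := ha
  obtain ⟨y, hy⟩ := hb
  obtain ⟨x', y', hx', -, hz⟩ := oplus_rearrange hx hy h
  exact ⟨x', hx', le_left hz⟩

theorem oplus_mono {a b a₁ b₁ c c₁ : E} (h : oplus a b = some c) (h₁ : oplus a₁ b₁ = some c₁)
    (ha : a₁ ≤ a) (hb : b₁ ≤ b) : c₁ ≤ c := by
  obtain ⟨d, hd, hdc⟩ := exists_oplus_mono h ha hb
  rwa [Option.some.inj (h₁.symm.trans hd)]

theorem ortho_antitone {a b : E} (h : a ≤ b) : ortho b ≤ ortho a := by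
  obtain ⟨c, hc, -⟩ := exists_oplus_mono (oplus_ortho b) h le_rfl
  exact exists_oplus_iff.1 ⟨c, oplus_comm _ _ _ hc⟩

theorem le_ortho_comm {a b : E} (h : a ≤ ortho b) : b ≤ ortho a := by
  simpa [ortho_ortho] using ortho_antitone h

theorem pick_eq {p : E → Prop} {x : E} (hx : p x) (h : ∀ y, p y → y = x) : pick p = x := by
  have hex : ∃ x, p x := ⟨x, hx⟩
  rw [pick, dif_pos hex]
  exact h _ hex.choose_spec

theorem pick_spec {p : E → Prop} (hex : ∃ x, p x) : p (pick p) := by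
  rw [pick, dif_pos hex]
  exact hex.choose_spec

theorem ominus_eq {a b c : E} (h : oplus a c = some b) : ominus b a = c :=
  pick_eq h fun _ hy => oplus_left_cancel hy h

theorem meet_eq {a b m : E} (ha : m ≤ a) (hb : m ≤ b) (h : ∀ z, z ≤ a → z ≤ b → z ≤ m) :
    meet a b = m := by
  have hm : IsGLB {a, b} m := by
    refine ⟨by simp [ha, hb], fun z hz => ?_⟩
    exact h z (hz (by simp)) (hz (by simp))
  exact pick_eq hm fun y hy => hy.unique hm

theorem IsSum.add {m m' : Multiset E} {x y z : E} (hx : IsSum m x) (hy : IsSum m' y)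
    (hz : oplus x y = some z) : IsSum (m + m') z := by
  induction hx generalizing z with
  | zero =>
    rw [zero_oplus] at hz
    cases hz
    simpa using hy
  | cons a m x x' hx hxx' ih =>
    obtain ⟨t, ht, ht'⟩ := oplus_assoc _ _ _ _ _ hxx' hz
    rw [Multiset.cons_add]
    exact IsSum.cons _ _ _ _ (ih ht) ht'

/-- Associativity and commutativity let any element of the multiset be peeled off, not only the one
inserted last; uniqueness of sums depends on this. -/
theorem IsSum.of_cons {a : E} {m : Multiset E} {y : E} (h : IsSum (a ::ₘ m) y) :
    ∃ x, IsSum m x ∧ oplus a x = some y := by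
  generalize hn : a ::ₘ m = n at h
  induction h generalizing m with
  | zero => simp at hn
  | cons b n x y hx hxy ih =>
    rcases Multiset.cons_eq_cons.1 hn with ⟨rfl, rfl⟩ | ⟨-, k, rfl, rfl⟩
    · exact ⟨x, hx, hxy⟩
    · obtain ⟨z, hz, hzx⟩ := ih rfl
      obtain ⟨t, ht, ht'⟩ := oplus_assoc_right hzx hxy
      obtain ⟨r, hr, hr'⟩ := oplus_assoc _ _ _ _ _ (oplus_comm _ _ _ ht) ht'
      exact ⟨r, IsSum.cons _ _ _ _ hz hr, hr'⟩

theorem IsSum.unique {m : Multiset E} {x y : E} (hx : IsSum m x) (hy : IsSum m y) : x = y := by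
  induction hx generalizing y with
  | zero => generalize hn : (0 : Multiset E) = n at hy; cases hy <;> simp_all
  | cons a m x x' _ hxx' ih =>
    obtain ⟨z, hz, hzy⟩ := hy.of_cons
    rw [← ih hz, hxx'] at hzy
    exact Option.some.inj hzy

theorem IsSum.singleton (a : E) : IsSum {a} a := IsSum.cons _ _ _ _ IsSum.zero (oplus_zero a)

theorem IsAdditive.mono {J : E → E} (hJ : IsAdditive J) {a b : E} (h : a ≤ b) : J a ≤ J b := by
  obtain ⟨c, hc⟩ := h
  exact ⟨_, hJ _ _ _ hc⟩

namespace IsState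

variable {s : E → ℝ}

theorem nonneg (hs : IsState s) (a : E) : 0 ≤ s a := (hs.mem_Icc a).1

theorem le_one (hs : IsState s) (a : E) : s a ≤ 1 := (hs.mem_Icc a).2

theorem map_zero (hs : IsState s) : s 0 = 0 := by
  have := hs.map_oplus _ _ _ (oplus_zero (0 : E))
  linarith

theorem mono (hs : IsState s) {a b : E} (h : a ≤ b) : s a ≤ s b := by
  obtain ⟨c, hc⟩ := h
  rw [hs.map_oplus _ _ _ hc]
  linarith [hs.nonneg c]

theorem map_ortho (hs : IsState s) (a : E) : s (ortho a) = 1 - s a := by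
  have := hs.map_oplus _ _ _ (oplus_ortho a)
  rw [hs.map_one] at this
  linarith

theorem map_isSum (hs : IsState s) {m : Multiset E} {x : E} (h : IsSum m x) : s x = (m.map s).sum := by
  induction h with
  | zero => simpa using hs.map_zero
  | cons a m x y _ hxy ih => rw [hs.map_oplus _ _ _ hxy, ih, Multiset.map_cons, Multiset.sum_cons]

end IsState

end Algebra

namespace CompressionBase

variable {E : Type*} [EffectAlgebra E] {K : CompressionBase E}

/-! ### Projections, commutants and compatible compressions. -/

section Projections

variable {p q : E}

theorem ortho_mem (hp : p ∈ K.P) : ortho p ∈ K.P := K.isSub.ortho_mem _ hp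

theorem J_additive (hp : p ∈ K.P) : IsAdditive (K.J p) := (K.isCompression p hp).additive

theorem J_mono (hp : p ∈ K.P) {a b : E} (h : a ≤ b) : K.J p a ≤ K.J p b :=
  (J_additive hp).mono h

theorem J_le (hp : p ∈ K.P) (a : E) : K.J p a ≤ p := by
  simpa [K.focus p hp] using J_mono hp (le_one' a)

theorem J_eq_self (hp : p ∈ K.P) {a : E} (h : a ≤ p) : K.J p a = a :=
  (K.isCompression p hp).eq_self a (by rwa [K.focus p hp])

theorem J_eq_zero_iff (hp : p ∈ K.P) {a : E} : K.J p a = 0 ↔ a ≤ ortho p := by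
  rw [(K.isCompression p hp).eq_zero_iff, K.focus p hp]

theorem J_ortho_eq_zero_iff (hp : p ∈ K.P) {a : E} : K.J (ortho p) a = 0 ↔ a ≤ p := by
  rw [J_eq_zero_iff (ortho_mem hp), ortho_ortho]

/-- Projections are principal: `J_p` fixes both summands, hence their sum. -/
theorem oplus_le_of_le (hp : p ∈ K.P) {a b c : E} (ha : a ≤ p) (hb : b ≤ p)
    (h : oplus a b = some c) : c ≤ p := by
  have := J_additive hp _ _ _ h
  rw [J_eq_self hp ha, J_eq_self hp hb, h] at this
  rw [Option.some.inj this]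
  exact J_le hp c

theorem eq_zero_of_le_of_le_ortho (hp : p ∈ K.P) {a : E} (h : a ≤ p) (h' : a ≤ ortho p) :
    a = 0 := by
  rw [← J_eq_self hp h, J_eq_zero_iff hp]
  exact h'

theorem ominus_mem (hp : p ∈ K.P) (hq : q ∈ K.P) {r : E} (h : oplus p r = some q) : r ∈ K.P := by
  obtain ⟨z, hz, hz'⟩ := oplus_assoc _ _ _ _ _ (oplus_comm _ _ _ h) (oplus_ortho q)
  have hzP := K.isSub.oplus_mem _ hp _ (ortho_mem hq) _ hz
  rw [ortho_unique (oplus_comm _ _ _ hz') (oplus_ortho z)]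
  exact ortho_mem hzP

/-- An element commutes with `p` iff it splits along `p` and `p'`. -/
theorem mem_comm_of_oplus (hp : p ∈ K.P) {a x y : E} (hx : x ≤ p) (hy : y ≤ ortho p)
    (h : oplus x y = some a) : a ∈ K.comm p := by
  have h1 := J_additive hp _ _ _ h
  have h2 := J_additive (ortho_mem hp) _ _ _ h
  rw [J_eq_self hp hx, (J_eq_zero_iff hp).2 hy, oplus_zero] at h1
  rw [J_eq_self (ortho_mem hp) hy, (J_ortho_eq_zero_iff hp).2 hx, zero_oplus] at h2
  rw [comm, Set.mem_ofPred_eq, ← Option.some.inj h1, ← Option.some.inj h2, h]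

theorem mem_comm_of_le (hp : p ∈ K.P) {a : E} (h : a ≤ p) : a ∈ K.comm p :=
  mem_comm_of_oplus hp h (zero_le' _) (oplus_zero a)

theorem J_le_self {a : E} (h : a ∈ K.comm p) : K.J p a ≤ a := le_left h

theorem mem_comm_ortho {a : E} (h : a ∈ K.comm p) : a ∈ K.comm (ortho p) := by
  rw [comm, Set.mem_ofPred_eq, ortho_ortho]
  exact oplus_comm _ _ _ h

/-- Regrouping `p ⊕ p' = 1` by means of `p = J_p(a) ⊕ J_p(a')` and the same for `p'` exhibits
`J_p(a') ⊕ J_{p'}(a')` as the orthosupplement of `a`. -/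
theorem ortho_mem_comm (hp : p ∈ K.P) {a : E} (h : a ∈ K.comm p) : ortho a ∈ K.comm p := by
  have h1 := J_additive hp _ _ _ (oplus_ortho a)
  have h2 := J_additive (ortho_mem hp) _ _ _ (oplus_ortho a)
  rw [K.focus p hp] at h1
  rw [K.focus _ (ortho_mem hp)] at h2
  obtain ⟨x, y, hx, hy, hxy⟩ := oplus_rearrange h1 h2 (oplus_ortho p)
  obtain rfl := Option.some.inj (hx.symm.trans h)
  rw [ortho_unique hxy (oplus_ortho _)] at hy
  exact hy

theorem mem_comm_of_oplus_mem_comm (hp : p ∈ K.P) {a b x : E} (ha : a ∈ K.comm p)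
    (hb : b ∈ K.comm p) (h : oplus a x = some b) : x ∈ K.comm p := by
  have h1 := J_additive hp _ _ _ h
  have h2 := J_additive (ortho_mem hp) _ _ _ h
  obtain ⟨y, z, hy, hz, hyz⟩ := oplus_rearrange h1 h2 hb
  obtain rfl := Option.some.inj (hy.symm.trans ha)
  rw [oplus_left_cancel hyz h] at hz
  exact hz

theorem mackey_of_mem_comm (hp : p ∈ K.P) (h : q ∈ K.comm p) : Mackey q p := by
  obtain ⟨r, hr⟩ := J_le hp q
  have hq : oplus (K.J (ortho p) q) (K.J p q) = some q := oplus_comm _ _ _ h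
  obtain ⟨y, hy⟩ := exists_oplus_iff.2 (J_le (ortho_mem hp) q)
  obtain ⟨x, hx, hx'⟩ := oplus_assoc_right (oplus_comm _ _ _ hr) hy
  exact ⟨_, r, _, x, y, hx, hx', hq, oplus_comm _ _ _ hr⟩

theorem Mackey.symm {a b : E} (h : Mackey a b) : Mackey b a := by
  obtain ⟨a₁, b₁, c, x, y, h1, h2, h3, h4⟩ := h
  exact ⟨b₁, a₁, c, x, y, oplus_comm _ _ _ h1, h2, h4, h3⟩

theorem J_eq_of_mackey (hp : p ∈ K.P) {a₁ b₁ c x y : E} (h₁ : oplus a₁ b₁ = some x)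
    (h₂ : oplus x c = some y) (h₃ : oplus a₁ c = some p) (h₄ : oplus b₁ c = some q) :
    K.J p q = c ∧ b₁ ≤ ortho p := by
  have hb : b₁ ≤ ortho p := by
    obtain ⟨z, hz, hz'⟩ := oplus_assoc _ _ _ _ _ (oplus_comm _ _ _ h₁) h₂
    obtain rfl := Option.some.inj (hz.symm.trans h₃)
    exact exists_oplus_iff.1 ⟨_, hz'⟩
  refine ⟨?_, hb⟩
  have := J_additive hp _ _ _ h₄
  rw [(J_eq_zero_iff hp).2 hb, J_eq_self hp (le_right h₃), zero_oplus] at this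
  exact (Option.some.inj this).symm

theorem mem_comm_of_mackey (hp : p ∈ K.P) (h : Mackey p q) : q ∈ K.comm p := by
  obtain ⟨a₁, b₁, c, x, y, h1, h2, h3, h4⟩ := h
  exact mem_comm_of_oplus hp (le_right h3) (J_eq_of_mackey hp h1 h2 h3 h4).2
    (oplus_comm _ _ _ h4)

theorem mem_comm_symm (hp : p ∈ K.P) (hq : q ∈ K.P) (h : q ∈ K.comm p) : p ∈ K.comm q :=
  mem_comm_of_mackey hq (mackey_of_mem_comm hp h)

/-- Compressions with compatible foci commute. -/
theorem J_comm (hp : p ∈ K.P) (hq : q ∈ K.P) (h : q ∈ K.comm p) (a : E) :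
    K.J p (K.J q a) = K.J q (K.J p a) := by
  have hM := mackey_of_mem_comm hp h
  obtain ⟨r, hr, hpq⟩ := K.comp p hp q hq (Mackey.symm hM)
  obtain ⟨t, ht, hqp⟩ := K.comp q hq p hp hM
  have hr' : K.J p q = r := by
    rw [← K.focus r hr, ← hpq, Function.comp_apply, K.focus q hq]
  have ht' : K.J q p = t := by
    rw [← K.focus t ht, ← hqp, Function.comp_apply, K.focus p hp]
  -- Each composite is a member of the base, indexed by its focus; both foci equal the common part
  -- `c` of `p` and `q`.
  obtain ⟨a₁, b₁, c, x, y, h1, h2, h3, h4⟩ := hM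
  have e1 := (J_eq_of_mackey hq h1 h2 h3 h4).1
  have e2 := (J_eq_of_mackey hp (oplus_comm _ _ _ h1) h2 h4 h3).1
  have hrt : r = t := by rw [← hr', ← ht', e1, e2]
  have := congrFun (hpq.trans ((congrArg K.J hrt).trans hqp.symm)) a
  exact this

theorem J_J_of_le (hp : p ∈ K.P) (hq : q ∈ K.P) (h : p ≤ q) (a : E) :
    K.J p (K.J q a) = K.J p a := by
  rw [J_comm hp hq (mem_comm_symm hq hp (mem_comm_of_le hq h)), J_eq_self hq]
  exact (J_le hp a).trans h

theorem J_mem_comm (hp : p ∈ K.P) (hq : q ∈ K.P) (h : q ∈ K.comm p) {a : E}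
    (ha : a ∈ K.comm q) : K.J p a ∈ K.comm q := by
  have := J_additive hp _ _ _ ha
  rw [J_comm hp hq h, J_comm hp (ortho_mem hq) (ortho_mem_comm hp h)] at this
  exact this

end Projections

/-! ### Projection covers. -/

section Cover

theorem IsProjCover.unique {a p q : E} (hp : K.IsProjCover a p) (hq : K.IsProjCover a q) :
    p = q :=
  le_antisymm ((hp.2 q hq.1).1 ((hq.2 q hq.1).2 le_rfl))
    ((hq.2 p hp.1).1 ((hp.2 p hp.1).2 le_rfl))

theorem IsSpectral.cover_spec (hK : K.IsSpectral) (a : E) : K.IsProjCover a (K.cover a) :=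
  pick_spec (hK.projCover a)

theorem IsSpectral.cover_mem (hK : K.IsSpectral) (a : E) : K.cover a ∈ K.P := (hK.cover_spec a).1

theorem IsSpectral.le_cover (hK : K.IsSpectral) (a : E) : a ≤ K.cover a :=
  ((hK.cover_spec a).2 _ (hK.cover_mem a)).2 le_rfl

theorem IsSpectral.cover_le (hK : K.IsSpectral) {a q : E} (hq : q ∈ K.P) (h : a ≤ q) :
    K.cover a ≤ q := ((hK.cover_spec a).2 q hq).1 h

/-- A projection commuting with `x` commutes with its projection cover. -/
theorem IsSpectral.cover_mem_comm (hK : K.IsSpectral) {x q : E} (hq : q ∈ K.P)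
    (hx : x ∈ K.comm q) : K.cover x ∈ K.comm q := by
  have h1 := hK.cover_le hq (J_le hq x)
  have h2 := hK.cover_le (ortho_mem hq) (J_le (ortho_mem hq) x)
  -- The covers of the two parts of `x` lie below `q` and `q'`, so their sum `r` exists; it is a
  -- projection between `x` and `x°`, hence equal to `x°`.
  obtain ⟨r, hr, -⟩ := exists_oplus_mono (oplus_ortho q) h1 h2
  have hrP := K.isSub.oplus_mem _ (hK.cover_mem _) _ (hK.cover_mem _) _ hr
  have hxr : x ≤ r := oplus_mono hr hx (hK.le_cover _) (hK.le_cover _)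
  have hrx : r ≤ K.cover x :=
    oplus_le_of_le (hK.cover_mem x)
      (hK.cover_le (hK.cover_mem x) ((le_left hx).trans (hK.le_cover x)))
      (hK.cover_le (hK.cover_mem x) ((le_right hx).trans (hK.le_cover x))) hr
  rw [le_antisymm (hK.cover_le hrP hxr) hrx]
  exact mem_comm_of_oplus hq h1 h2 hr

end Cover

/-! ### Compatibility, positive parts and the comparing projection. -/

section Comparability

/-- Only the orders are assumed to agree, so the lattice operations must be tied to `⊕`. The
difference `X ⊖ (X ⊓ Y)` is disjoint from `Y` because projections are sharp, and `Y'` is codisjoint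
with `Y` because they are principal; so the difference lies below `Y'`. -/
theorem mackey_of_booleanAlgebra {B : Set E} (hBP : B ⊆ K.P) (hB : IsSubEffectAlgebra B)
    {β : Type*} [BooleanAlgebra β] {f : β → E} (hf : Set.range f = B)
    (hle : ∀ x y, x ≤ y ↔ f x ≤ f y) (X Y : β) : Mackey (f X) (f Y) := by
  have hmem : ∀ b, f b ∈ B := fun b => hf ▸ Set.mem_range_self b
  have hsurj : ∀ x ∈ B, ∃ b, f b = x := fun x hx => by rwa [← hf] at hx
  obtain ⟨u, hu⟩ : f (X ⊓ Y) ≤ f X := (hle _ X).1 inf_le_left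
  obtain ⟨v, hv⟩ : f (X ⊓ Y) ≤ f Y := (hle _ Y).1 inf_le_right
  have huB : u ∈ B := by
    obtain ⟨z, hz, hz'⟩ := oplus_assoc _ _ _ _ _ (oplus_comm _ _ _ hu) (oplus_ortho (f X))
    have hzB := hB.oplus_mem _ (hmem _) _ (hB.ortho_mem _ (hmem X)) _ hz
    rw [ortho_unique (oplus_comm _ _ _ hz') (oplus_ortho z)]
    exact hB.ortho_mem _ hzB
  obtain ⟨U, rfl⟩ := hsurj u huB
  obtain ⟨Y', hY'⟩ := hsurj _ (hB.ortho_mem _ (hmem Y))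
  have hdisj : Disjoint U Y := by
    intro Z h1 h2
    have hu1 : f Z ≤ f U := (hle Z U).1 h1
    have hZD : Z ≤ X ⊓ Y := le_inf ((hle Z X).2 (hu1.trans (le_right hu))) h2
    rw [hle, eq_zero_of_le_of_le_ortho (hBP (hmem _)) ((hle _ _).1 hZD)
      (hu1.trans (exists_oplus_iff.1 ⟨_, oplus_comm _ _ _ hu⟩))]
    exact zero_le' _
  have hcod : Codisjoint Y Y' := by
    intro Z h1 h2
    obtain ⟨T, hT⟩ := hsurj 1 hB.one_mem
    rw [hle] at h1 h2
    rw [hY'] at h2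
    have h3 : T ≤ Z := by
      rw [hle, hT]
      exact oplus_le_of_le (hBP (hmem Z)) h1 h2 (oplus_ortho _)
    refine le_trans ((hle _ _).2 ?_) h3
    rw [hT]
    exact le_one' _
  have hUY := (hle _ _).1 (hdisj.le_of_codisjoint hcod)
  rw [hY'] at hUY
  obtain ⟨w, hw⟩ := exists_oplus_iff.2 hUY
  obtain ⟨t, ht, ht'⟩ := oplus_assoc_right (oplus_comm _ _ _ hv) hw
  exact ⟨f U, v, f (X ⊓ Y), t, w, ht, ht', oplus_comm _ _ _ hu, oplus_comm _ _ _ hv⟩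

/-- Elements of a Boolean subalgebra are pairwise Mackey compatible. -/
theorem IsBooleanSubalgebra.mackey {B : Set E} (hB : K.IsBooleanSubalgebra B) {x y : E}
    (hx : x ∈ B) (hy : y ∈ B) : Mackey x y := by
  obtain ⟨inst, hle⟩ := hB.boolean
  exact @mackey_of_booleanAlgebra E _ K B hB.subset hB.isSub B inst Subtype.val
    Subtype.range_coe hle ⟨x, hx⟩ ⟨y, hy⟩

/-- A projection commuting with every projection in `PC(c)` commutes with `c`. -/
theorem IsSpectral.mem_comm (hK : K.IsSpectral) {c e : E} (he : e ∈ K.P)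
    (h : ∀ q ∈ K.P, c ∈ K.comm q → e ∈ K.comm q) : c ∈ K.comm e := by
  obtain ⟨B, hB, hBc⟩ := hK.bComparability.b_property c
  refine (hBc e he).2 fun b hb => ?_
  have hbP := hB.subset hb
  -- The b-property is used twice: `b` commutes with all of `B`, hence with `c`, so the hypothesis
  -- applies to it.
  have hcb : c ∈ K.comm b :=
    (hBc b hbP).2 fun b' hb' => mem_comm_of_mackey hbP (hB.mackey hb hb')
  exact mem_comm_symm hbP he (h b hbP hcb)

/-- The positive part does not depend on the choice of the comparing projection. -/
theorem oplus_unique_of_mem_Ple {e f p q x y : E} (hp : p ∈ K.Ple e f) (hq : q ∈ K.Ple e f)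
    (hx : oplus (K.J p e) x = some (K.J p f)) (hy : oplus (K.J q e) y = some (K.J q f)) :
    x = y := by
  -- The reverse comparison on `q'` forces `J_{q'}(x) = 0`, so `x = J_q(x)` is the difference of
  -- `J_q J_p f` and `J_q J_p e`, which is symmetric in `p` and `q`.
  have aux : ∀ {p q x : E}, p ∈ K.Ple e f → q ∈ K.Ple e f →
      oplus (K.J p e) x = some (K.J p f) →
      oplus (K.J q (K.J p e)) x = some (K.J q (K.J p f)) := by
    intro p q x hp hq hx
    have hpP := hp.1.1
    have hqP := hq.1.1
    have hqp : q ∈ K.comm p := hp.1.2 q (Or.inl ⟨hqP, fun a ha => hq.1.2 a (Or.inr ha)⟩)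
    have hqp' := ortho_mem_comm hpP hqp
    have h0 := J_additive (ortho_mem hqP) _ _ _ hx
    have h1 := J_mono hpP hq.2.2
    rw [J_comm hpP (ortho_mem hqP) hqp', J_comm hpP (ortho_mem hqP) hqp'] at h1
    rw [le_antisymm (le_left h0) h1] at h0
    have hxq := (J_ortho_eq_zero_iff hqP).1 (eq_zero_of_oplus_eq_self h0)
    have h2 := J_additive hqP _ _ _ hx
    rwa [J_eq_self hqP hxq] at h2
  have h1 := aux hp hq hx
  have h2 := aux hq hp hy
  have hqp : q ∈ K.comm p :=
    hp.1.2 q (Or.inl ⟨hq.1.1, fun a ha => hq.1.2 a (Or.inr ha)⟩)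
  rw [J_comm hp.1.1 hq.1.1 hqp, J_comm hp.1.1 hq.1.1 hqp] at h2
  exact oplus_left_cancel h1 h2

theorem posPart_eq {e f p x : E} (hp : p ∈ K.Ple e f)
    (hx : oplus (K.J p e) x = some (K.J p f)) : K.posPart f e = x :=
  pick_eq ⟨p, hp, hx⟩ fun _ ⟨_, hq, hy⟩ => oplus_unique_of_mem_Ple hq hp hy hx

theorem ortho_mem_Ple {e f p : E} (hp : p ∈ K.Ple e f) : ortho p ∈ K.Ple f e := by
  refine ⟨⟨ortho_mem hp.1.1, fun a ha => mem_comm_ortho (hp.1.2 a ?_)⟩, hp.2.2, ?_⟩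
  · rwa [Set.pair_comm]
  · rw [ortho_ortho]
    exact hp.2.1

/-- Commuting with `c'` amounts to commuting with `c`, so `P(c') ⊆ PC(c)`, and `P(c)` commutes with
`PC(c)`. This makes comparability available for `c'` and `c`. -/
theorem commute_ortho_self (c : E) : K.Commute (ortho c) c := by
  intro p hp q hq
  have : p ∈ K.PC {c} := ⟨hp.1, fun a ha => by
    rw [Set.mem_singleton_iff.1 ha, ← ortho_ortho c]
    exact ortho_mem_comm hp.1 (hp.2 _ (Or.inr rfl))⟩
  exact mackey_of_mem_comm hq.1 (hq.2 p (Or.inl this))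

/-- The projection cover of `(c - c')_+` compares `c'` and `c`. -/
theorem IsSpectral.cover_posPart_mem_Ple (hK : K.IsSpectral) (c : E) :
    K.cover (K.posPart c (ortho c)) ∈ K.Ple (ortho c) c := by
  obtain ⟨p, hp⟩ := hK.bComparability.nonempty _ _ (commute_ortho_self (K := K) c)
  obtain ⟨x, hx⟩ := hp.2.1
  rw [posPart_eq hp hx]
  have hpP := hp.1.1
  have hcp : c ∈ K.comm p := hp.1.2 c (Or.inr (by simp))
  have hcp' : ortho c ∈ K.comm p := ortho_mem_comm hpP hcp
  set e := K.cover x with he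
  have heP : e ∈ K.P := hK.cover_mem x
  have hep : e ≤ p := hK.cover_le hpP ((le_right hx).trans (J_le hpP c))
  -- Such a `q` commutes with `p` and `c`, hence with `x`, hence with the cover of `x`.
  have hcomm : ∀ q ∈ K.P, c ∈ K.comm q → e ∈ K.comm q := by
    intro q hq hcq
    have hcq' := ortho_mem_comm hq hcq
    have hqp : q ∈ K.comm p := by
      refine hp.1.2 q (Or.inl ⟨hq, fun a ha => ?_⟩)
      rcases ha with rfl | rfl <;> assumption
    exact hK.cover_mem_comm hq (mem_comm_of_oplus_mem_comm hq (J_mem_comm hpP hq hqp hcq')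
      (J_mem_comm hpP hq hqp hcq) hx)
  have hce : c ∈ K.comm e := hK.mem_comm heP hcomm
  have hec' : ortho c ∈ K.comm e := ortho_mem_comm heP hce
  refine ⟨⟨heP, ?_⟩, ?_, ?_⟩
  · rintro a (ha | rfl | rfl)
    · exact mem_comm_symm ha.1 heP (hcomm a ha.1 (ha.2 c (by simp)))
    · exact hec'
    · exact hce
  · have := J_additive heP _ _ _ hx
    rw [J_J_of_le heP hpP hep, J_J_of_le heP hpP hep] at this
    exact le_left this
  -- On `e'` the element `x` vanishes, so `c` and `c'` agree on the part below `p`; on `p'` they are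
  -- compared by `p`.
  · have heP' := ortho_mem heP
    have h1 := J_additive heP' _ _ _ hx
    rw [(J_ortho_eq_zero_iff heP).2 (hK.le_cover x), oplus_zero] at h1
    have h2 := Option.some.inj h1
    have hpe := ortho_antitone hep
    have h3 := J_additive heP' _ _ _ hcp
    have h4 := J_additive heP' _ _ _ hcp'
    rw [J_eq_self heP' ((J_le (ortho_mem hpP) _).trans hpe)] at h3 h4
    rw [h2] at h4
    exact oplus_mono h4 h3 le_rfl hp.2.2

end Comparability

/-! ### One step of the binary expansion. -/

section Splitting

/-- Any `z` below `p'` and `u` satisfies `z = J_{p'}(z) ≤ J_{p'}(u) = u ⊖ p`. -/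
theorem meet_ortho_eq {p q u : E} (hp : p ∈ K.P) (h : oplus p q = some u) :
    meet (ortho p) u = q := by
  have hq : q ≤ ortho p := exists_oplus_iff.1 ⟨_, oplus_comm _ _ _ h⟩
  refine meet_eq hq (le_right h) fun z h1 h2 => ?_
  have h3 := J_additive (ortho_mem hp) _ _ _ h
  rw [(J_ortho_eq_zero_iff hp).2 le_rfl, J_eq_self (ortho_mem hp) hq, zero_oplus] at h3
  rw [Option.some.inj h3, ← J_eq_self (ortho_mem hp) h1]
  exact J_mono (ortho_mem hp) h2

theorem meet_comm (a b : E) : meet a b = meet b a := by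
  rw [meet, meet, Set.pair_comm]

theorem meet_eq_left {a b : E} (h : a ≤ b) : meet a b = a :=
  meet_eq le_rfl h fun _ hz _ => hz

/-- The properties of one splitting step, from `c ≤ u` to `c₀ ≤ u₀` and `c₁ ≤ u₁`: on `u₀` the
element `c` is doubled, on `u₁` it is doubled after subtracting one half. -/
structure IsSplitting (K : CompressionBase E) (u c u₀ c₀ u₁ c₁ : E) : Prop where
  u₀_mem : u₀ ∈ K.P
  u₁_mem : u₁ ∈ K.P
  oplus_eq : oplus u₀ u₁ = some u
  c₀_le : c₀ ≤ u₀
  c₁_le : c₁ ≤ u₁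
  mem_comm : c ∈ K.comm u₁
  c₀_eq : oplus (K.J (ortho u₁) c) (K.J (ortho u₁) c) = some c₀
  c₁_eq : oplus (K.J u₁ (ortho c)) c₁ = some (K.J u₁ c)

theorem IsSpectral.isSplitting_splitStep (hK : K.IsSpectral) {u c : E} (hu : u ∈ K.P)
    (hcu : c ≤ u) :
    IsSplitting K u c (K.splitStep (u, c) false).1 (K.splitStep (u, c) false).2
      (K.splitStep (u, c) true).1 (K.splitStep (u, c) true).2 := by
  have hPle := hK.cover_posPart_mem_Ple c
  obtain ⟨x, hx⟩ := hPle.2.1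
  have hx' := posPart_eq hPle hx
  obtain ⟨y, hy⟩ := (ortho_mem_Ple hPle).2.1
  have hy' := posPart_eq (ortho_mem_Ple hPle) hy
  have hxe := hK.le_cover (K.posPart c (ortho c))
  have heP := hPle.1.1
  have hce : c ∈ K.comm _ := hPle.1.2 c (Or.inr (by simp))
  simp only [splitStep, hy', if_true, if_false, Bool.false_eq_true]
  rw [hx'] at hxe
  simp only [hx'] at heP hce hx hy ⊢
  set e := K.cover x
  have heP' := ortho_mem heP
  -- Here `e = J_e(c) ⊕ J_e(c')` with `J_e(c') ≤ J_e(c) ≤ c ≤ u`, and `u` is principal.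
  have heu : e ≤ u := by
    have h1 := J_additive heP _ _ _ (oplus_ortho c)
    rw [K.focus e heP] at h1
    have h2 := (J_le_self hce).trans hcu
    exact oplus_le_of_le hu h2 ((le_left hx).trans h2) h1
  obtain ⟨v, hv⟩ := heu
  have hvP : v ∈ K.P := ominus_mem heP hu hv
  have hve : oplus v e = some u := oplus_comm _ _ _ hv
  have hve' : v ≤ ortho e := exists_oplus_iff.1 ⟨_, hve⟩
  rw [meet_ortho_eq heP hv, meet_comm u, meet_ortho_eq hvP hve, meet_eq_left (hxe.trans (le_left hv))]
  obtain ⟨d, hd⟩ := hcu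
  have hJu : K.J (ortho e) u = v := by
    have := J_additive heP' _ _ _ hv
    rw [(J_ortho_eq_zero_iff heP).2 le_rfl, J_eq_self heP' hve', zero_oplus] at this
    exact (Option.some.inj this).symm
  have hJd := J_additive heP' _ _ _ hd
  rw [hJu] at hJd
  -- the complement of `c` is `d ⊕ u'`
  obtain ⟨f, hf, hf'⟩ := oplus_assoc _ _ _ _ _ hd (oplus_ortho u)
  obtain rfl := ortho_unique hf' (oplus_ortho c)
  have hJf := J_additive heP' _ _ _ hf
  rw [J_eq_self heP' (ortho_antitone (le_left hv))] at hJf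
  have hvu : v ≤ u := le_right hv
  -- Applying `J_u` to `J_{e'}(c) ≤ J_{e'}(c') = J_{e'}(d) ⊕ u'` removes `u'`.
  have hle : K.J (ortho e) c ≤ K.J (ortho e) d := by
    have h1 := J_mono hu (le_left hy)
    have h2 := J_additive hu _ _ _ hJf
    rw [(J_eq_zero_iff hu).2 le_rfl, J_eq_self hu ((le_right hJd).trans hvu), oplus_zero] at h2
    rwa [J_eq_self hu ((le_left hJd).trans hvu), ← Option.some.inj h2] at h1
  obtain ⟨z, hz⟩ := hle
  have hzv : z ≤ v := (le_right hz).trans (le_right hJd)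
  obtain ⟨t, ht, ht'⟩ := oplus_assoc _ _ _ _ _ hz hJf
  obtain rfl := oplus_left_cancel ht' hy
  have hmeet : meet t u = z := by
    refine meet_eq (le_left ht) (hzv.trans hvu) fun w h1 h2 => ?_
    have h3 := J_additive hu _ _ _ ht
    rw [(J_eq_zero_iff hu).2 le_rfl, oplus_zero, J_eq_self hu (hzv.trans hvu)] at h3
    rw [Option.some.inj h3, ← J_eq_self hu h2]
    exact J_mono hu h1
  -- With `z = (c' - c)_+ ∧ u`, the identity `v = J_{e'}(c) ⊕ J_{e'}(d)` becomes `v = 2 J_{e'}(c) ⊕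
  -- z`, so `v ⊖ z` is the doubled element.
  obtain ⟨r, hr, hr'⟩ := oplus_assoc_right hz hJd
  have hr'' := oplus_comm _ _ _ hr'
  rw [hmeet, ominus_eq hr'']
  exact ⟨hvP, heP, hve, le_right hr'', hxe, hce, hr, hx⟩

variable (K) in
theorem uc_append (a : E) (w : List Bool) (i : Bool) :
    K.uc a (w ++ [i]) = K.splitStep (K.uc a w) i := by
  simp [uc]

theorem IsSpectral.u_mem_and_c_le (hK : K.IsSpectral) (a : E) (w : List Bool) :
    K.u a w ∈ K.P ∧ K.c a w ≤ K.u a w := by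
  induction w using List.reverseRecOn with
  | nil => exact ⟨hK.cover_mem a, hK.le_cover a⟩
  | append_singleton w i ih =>
    have h := hK.isSplitting_splitStep ih.1 ih.2
    rw [u, c, uc_append]
    cases i
    · exact ⟨h.u₀_mem, h.c₀_le⟩
    · exact ⟨h.u₁_mem, h.c₁_le⟩

theorem IsSpectral.isSplitting (hK : K.IsSpectral) (a : E) (w : List Bool) :
    IsSplitting K (K.u a w) (K.c a w) (K.u a (w ++ [false])) (K.c a (w ++ [false]))
      (K.u a (w ++ [true])) (K.c a (w ++ [true])) := by
  have h := hK.u_mem_and_c_le a w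
  simpa only [u, c, uc_append] using hK.isSplitting_splitStep h.1 h.2

/-- Passing from `c` to `c₀` and `c₁` doubles the value of a state up to the carry `u₁`. -/
theorem IsSplitting.map_state {u c u₀ c₀ u₁ c₁ : E} (h : IsSplitting K u c u₀ c₀ u₁ c₁)
    {s : E → ℝ} (hs : IsState s) : s c₀ + s c₁ + s u₁ = 2 * s c := by
  -- From `u₁ = J_{u₁}(c) ⊕ J_{u₁}(c')` it follows that `s(c₁) + s(u₁) = 2 s(J_{u₁}(c))`.
  have h1 := J_additive h.u₁_mem _ _ _ (oplus_ortho c)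
  rw [K.focus _ h.u₁_mem] at h1
  linarith [hs.map_oplus _ _ _ h.c₀_eq, hs.map_oplus _ _ _ h.c₁_eq,
    hs.map_oplus _ _ _ h.mem_comm, hs.map_oplus _ _ _ h1]

end Splitting

end CompressionBase

/-! ### Binary strings, their values and their order. -/

section Strings

theorem lam_nil : lam [] = 0 := by simp [lam]

theorem lam_cons (i : Bool) (w : List Bool) :
    lam (i :: w) = (if i then 1 / 2 else 0) + lam w / 2 := by
  have h : lam (i :: w) = ∑ j : Fin (w.length + 1),
      if (i :: w).get j then (1 / 2 : ℚ) ^ ((j : ℕ) + 1) else 0 := rfl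
  rw [h, Fin.sum_univ_succ, lam, Finset.sum_div]
  congr 1
  · simp
  · refine Finset.sum_congr rfl fun j _ => ?_
    simp only [List.get_cons_succ', Fin.val_succ]
    split_ifs <;> ring

theorem lam_append (w : List Bool) (i : Bool) :
    lam (w ++ [i]) = lam w + if i then (1 / 2) ^ (w.length + 1) else 0 := by
  induction w with
  | nil => simp [lam_cons, lam_nil]
  | cons j w ih =>
    rw [List.cons_append, lam_cons, lam_cons, ih, List.length_cons]
    split_ifs <;> ring

theorem lam_nonneg (w : List Bool) : 0 ≤ lam w := by
  induction w with
  | nil => simp [lam_nil]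
  | cons j w ih => rw [lam_cons]; split_ifs <;> linarith

theorem lam_lt_one (w : List Bool) : lam w < 1 := by
  induction w with
  | nil => simp [lam_nil]
  | cons j w ih => rw [lam_cons]; split_ifs <;> linarith

theorem lam_append_true_pos (w : List Bool) : 0 < lam (w ++ [true]) := by
  rw [lam_append, if_pos rfl]
  have := lam_nonneg w
  positivity

/-- The value is `1/2` for the string `1` alone; otherwise it lies strictly on one side of `1/2`,
which reveals the first bit. Hence the string chosen in `specProj` is the intended one. -/
theorem lam_append_true_injective {v w : List Bool} (h : lam (v ++ [true]) = lam (w ++ [true])) :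
    v = w := by
  induction v generalizing w with
  | nil =>
    cases w with
    | nil => rfl
    | cons j w =>
      have h1 := lam_append_true_pos w
      have h2 := lam_lt_one (w ++ [true])
      simp only [List.nil_append, List.cons_append, lam_cons, lam_nil] at h
      exfalso
      cases j <;> simp at h <;> linarith
  | cons i v ih =>
    have h1 := lam_append_true_pos v
    have h2 := lam_lt_one (v ++ [true])
    cases w with
    | nil =>
      simp only [List.nil_append, List.cons_append, lam_cons, lam_nil] at h
      exfalso
      cases i <;> simp at h <;> linarith
    | cons j w =>
      have h3 := lam_append_true_pos w
      have h4 := lam_lt_one (w ++ [true])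
      simp only [List.cons_append, lam_cons] at h
      have hij : i = j := by
        cases i <;> cases j <;> simp at h ⊢ <;> linarith
      subst hij
      rw [ih (by linarith)]

theorem append_le_append_false {v w : List Bool} (h : v.length = w.length) (i : Bool) :
    v ++ [i] ≤ w ++ [false] ↔ v < w ∨ v = w ∧ i = false := by
  induction v generalizing w with
  | nil =>
    obtain rfl := List.length_eq_zero_iff.1 h.symm
    cases i
    · simp
    · simp [← not_lt, List.cons_lt_cons_iff]
  | cons a v ih =>
    cases w with
    | nil => simp at h
    | cons b w =>
      have hvw : w ++ [false] < v ++ [i] ↔ ¬ (v < w ∨ v = w ∧ i = false) := by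
        rw [← ih (by simpa using h), not_le]
      rw [List.cons_append, List.cons_append, ← not_lt, List.cons_lt_cons_iff,
        List.cons_lt_cons_iff, hvw, List.cons.injEq]
      rcases lt_trichotomy a b with hab | rfl | hab
      · simp [hab, hab.ne', hab.not_gt]
      · simp only [lt_irrefl, true_and, false_or, not_not]
      · simp [hab, hab.ne', hab.not_gt]

theorem binStrings_zero : binStrings 0 = {[]} := by
  ext w
  rw [mem_binStrings, Finset.mem_singleton, List.length_eq_zero_iff]

theorem sum_binStrings_succ {M : Type*} [AddCommMonoid M] (n : ℕ) (f : List Bool → M) :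
    ∑ w ∈ binStrings (n + 1), f w =
      ∑ w ∈ binStrings n, (f (w ++ [false]) + f (w ++ [true])) := by
  have h : binStrings (n + 1) = (binStrings n).image (· ++ [false]) ∪
      (binStrings n).image (· ++ [true]) := by
    ext w
    simp only [Finset.mem_union, Finset.mem_image, mem_binStrings]
    constructor
    · intro hw
      obtain ⟨v, i, rfl⟩ := (List.eq_nil_or_concat' w).resolve_left (by rintro rfl; simp at hw)
      cases i
      · exact Or.inl ⟨v, by simpa using hw, rfl⟩
      · exact Or.inr ⟨v, by simpa using hw, rfl⟩
    · rintro (⟨v, rfl, rfl⟩ | ⟨v, rfl, rfl⟩) <;> simp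
  rw [h, Finset.sum_union, Finset.sum_image, Finset.sum_image, Finset.sum_add_distrib]
  · intro x _ y _ hxy; simpa using hxy
  · intro x _ y _ hxy; simpa using hxy
  · rw [Finset.disjoint_left]
    intro w h1 h2
    obtain ⟨x, -, rfl⟩ := Finset.mem_image.1 h1
    obtain ⟨y, -, hy⟩ := Finset.mem_image.1 h2
    simpa using (List.append_inj' hy rfl).2

/-- Here the first letter is split off, not the last, so that an induction on `n` can descend the
tree below a fixed prefix. -/
theorem filter_binStrings_succ (n : ℕ) (q : List Bool → Prop) [DecidablePred q] :
    ((binStrings (n + 1)).filter q).val =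
      ((binStrings n).filter fun w => q (false :: w)).val.map (List.cons false) +
        ((binStrings n).filter fun w => q (true :: w)).val.map (List.cons true) := by
  have h : (binStrings (n + 1)).filter q =
      (((binStrings n).filter fun w => q (false :: w)).map ⟨List.cons false, List.cons_injective⟩).disjUnion
        (((binStrings n).filter fun w => q (true :: w)).map ⟨List.cons true, List.cons_injective⟩)
        (by
          rw [Finset.disjoint_left]
          intro w h1 h2
          obtain ⟨x, -, rfl⟩ := Finset.mem_map.1 h1
          obtain ⟨y, -, hy⟩ := Finset.mem_map.1 h2
          simp at hy) := by
    ext w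
    simp only [Finset.mem_disjUnion, Finset.mem_map, Finset.mem_filter, mem_binStrings,
      Function.Embedding.coeFn_mk]
    constructor
    · rintro ⟨hw, hq⟩
      cases w with
      | nil => simp at hw
      | cons i w =>
        cases i
        · exact Or.inl ⟨w, ⟨by simpa using hw, hq⟩, rfl⟩
        · exact Or.inr ⟨w, ⟨by simpa using hw, hq⟩, rfl⟩
    · rintro (⟨v, ⟨rfl, hq⟩, rfl⟩ | ⟨v, ⟨rfl, hq⟩, rfl⟩) <;> exact ⟨by simp, hq⟩
  rw [h]
  rfl

end Strings

namespace CompressionBase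

variable {E : Type*} [EffectAlgebra E] {K : CompressionBase E}

/-! ### The value of a state as a limit. -/

section Resolution

variable {s : E → ℝ}

/-- The carry `s(u_{w1})` of each splitting, weighted by `2^{-(n+1)}`, is exactly what the new last
digit adds to `λ`. -/
theorem IsSpectral.sum_add_sum_eq (hK : K.IsSpectral) (a : E) (hs : IsState s) (n : ℕ) :
    ∑ w ∈ binStrings n, (lam w : ℝ) * s (K.u a w) +
      (1 / 2) ^ n * ∑ w ∈ binStrings n, s (K.c a w) = s a := by
  induction n with
  | zero => simp [binStrings_zero, lam_nil, c, uc]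
  | succ n ih =>
    rw [← ih, sum_binStrings_succ, sum_binStrings_succ, Finset.mul_sum, Finset.mul_sum,
      ← Finset.sum_add_distrib, ← Finset.sum_add_distrib]
    refine Finset.sum_congr rfl fun w hw => ?_
    have h := hK.isSplitting a w
    have h1 := h.map_state hs
    have h2 := hs.map_oplus _ _ _ h.oplus_eq
    rw [lam_append, lam_append, mem_binStrings.1 hw, h2]
    push_cast
    simp only [if_true]
    push_cast
    have h3 : s (K.c a w) =
      (s (K.c a (w ++ [false])) + s (K.c a (w ++ [true])) + s (K.u a (w ++ [true]))) / 2 := by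
      linarith
    rw [h3]
    ring

theorem IsSpectral.sum_u_eq (hK : K.IsSpectral) (a : E) (hs : IsState s) (n : ℕ) :
    ∑ w ∈ binStrings n, s (K.u a w) = s (K.cover a) := by
  induction n with
  | zero => simp [binStrings_zero, u, uc]
  | succ n ih =>
    rw [← ih, sum_binStrings_succ]
    exact Finset.sum_congr rfl fun w _ => (hs.map_oplus _ _ _ (hK.isSplitting a w).oplus_eq).symm

theorem IsSpectral.tendsto_sum (hK : K.IsSpectral) (a : E) (hs : IsState s) :
    Filter.Tendsto (fun n : ℕ => ∑ w ∈ binStrings n, (lam w : ℝ) * s (K.u a w))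
      Filter.atTop (nhds (s a)) := by
  have hpow : Filter.Tendsto (fun n : ℕ => s a - (1 / 2 : ℝ) ^ n) Filter.atTop (nhds (s a)) := by
    simpa using (tendsto_const_nhds (x := s a)).sub
      (tendsto_pow_atTop_nhds_zero_of_lt_one (r := (1 / 2 : ℝ)) (by norm_num) (by norm_num))
  refine tendsto_of_tendsto_of_tendsto_of_le_of_le hpow tendsto_const_nhds (fun n => ?_)
    (fun n => ?_)
  · have h1 := hK.sum_add_sum_eq a hs n
    have h2 : ∑ w ∈ binStrings n, s (K.c a w) ≤ 1 := by
      calc _ ≤ ∑ w ∈ binStrings n, s (K.u a w) :=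
            Finset.sum_le_sum fun w _ => hs.mono (hK.u_mem_and_c_le a w).2
        _ ≤ 1 := by rw [hK.sum_u_eq a hs]; exact hs.le_one _
    have h3 := mul_le_mul_of_nonneg_left h2 (by positivity : (0 : ℝ) ≤ (1 / 2) ^ n)
    simp only
    linarith
  · have h1 := hK.sum_add_sum_eq a hs n
    have h2 : 0 ≤ ∑ w ∈ binStrings n, s (K.c a w) := Finset.sum_nonneg fun w _ => hs.nonneg _
    have h3 : 0 ≤ (1 / 2 : ℝ) ^ n * ∑ w ∈ binStrings n, s (K.c a w) := by positivity
    simp only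
    linarith

theorem IsSpectral.map_eq_zero_iff (hK : K.IsSpectral) (a : E) (hs : IsState s) :
    s a = 0 ↔ ∀ w : List Bool, lam w ≠ 0 → s (K.u a w) = 0 := by
  constructor
  · intro h w hw
    have h1 := hK.sum_add_sum_eq a hs w.length
    have h0 : ∀ v, 0 ≤ (lam v : ℝ) * s (K.u a v) := fun v =>
      mul_nonneg (by exact_mod_cast lam_nonneg v) (hs.nonneg _)
    have h2 : 0 ≤ ∑ w ∈ binStrings w.length, s (K.c a w) :=
      Finset.sum_nonneg fun w _ => hs.nonneg _
    have h3 : 0 ≤ (1 / 2 : ℝ) ^ w.length * ∑ v ∈ binStrings w.length, s (K.c a v) := by positivity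
    have h4 := Finset.single_le_sum (fun v _ => h0 v) (mem_binStrings.2 (rfl : w.length = _))
    have h5 : (lam w : ℝ) * s (K.u a w) = 0 := le_antisymm (by linarith) (h0 w)
    exact (mul_eq_zero.1 h5).resolve_left (by exact_mod_cast hw)
  · intro h
    refine tendsto_nhds_unique (hK.tendsto_sum a hs) ?_
    have : ∀ w, (lam w : ℝ) * s (K.u a w) = 0 := fun w => by
      by_cases hw : lam w = 0
      · simp [hw]
      · rw [h w hw, mul_zero]
    simp [this]

end Resolution

/-! ### The archimedean, σ-additive case. -/

section Archimedean

/-- If `r` lies below all `u_{0…0}`, the multiples `2ⁿ J_r(a)` exist. -/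
theorem IsSpectral.isSum_replicate (hK : K.IsSpectral) (a : E) {r : E} (hr : r ∈ K.P)
    (h : ∀ n, r ≤ K.u a (List.replicate n false)) (n : ℕ) :
    IsSum (Multiset.replicate (2 ^ n) (K.J r a)) (K.J r (K.c a (List.replicate n false))) := by
  induction n with
  | zero => exact IsSum.singleton (K.J r a)
  | succ n ih =>
    have hs := hK.isSplitting a (List.replicate n false)
    rw [← List.replicate_succ'] at hs
    have h1 := J_additive hr _ _ _ hs.c₀_eq
    -- Then `J_r` absorbs the compression occurring in `c₀ = 2 J_{u₁'}(c)`.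
    have hle : r ≤ ortho (K.u a (List.replicate n false ++ [true])) :=
      (h (n + 1)).trans (exists_oplus_iff.1 ⟨_, hs.oplus_eq⟩)
    rw [J_J_of_le hr (ortho_mem hs.u₁_mem) hle] at h1
    rw [pow_succ, mul_two, Multiset.replicate_add]
    exact ih.add ih h1

theorem isSum_le {m m' : Multiset E} {x : E} (h : m ≤ m') (hx : IsSum m' x) :
    ∃ y, IsSum m y := by
  obtain ⟨k, rfl⟩ := Multiset.le_iff_exists_add.1 h
  induction k using Multiset.induction_on generalizing x with
  | empty => exact ⟨x, by simpa using hx⟩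
  | cons b k ih =>
    rw [Multiset.add_cons] at hx
    obtain ⟨z, hz, -⟩ := hx.of_cons
    exact ih (Multiset.le_add_right _ _) hz

/-- Let `r = z°`. All multiples of `J_r(a)` exist, so `J_r(a) = 0` and `a° ≤ r'`; but `r ≤ a°`, the
term `n = 0`, so `r = 0`. -/
theorem IsSpectral.eq_zero_of_le_u (hK : K.IsSpectral) (hE : IsArchimedean E) (a : E) {z : E}
    (h : ∀ n, z ≤ K.u a (List.replicate n false)) : z = 0 := by
  have hr := hK.cover_mem z
  have hru : ∀ n, K.cover z ≤ K.u a (List.replicate n false) := fun n =>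
    hK.cover_le (hK.u_mem_and_c_le a _).1 (h n)
  have h0 : K.J (K.cover z) a = 0 := hE _ fun n => by
    refine isSum_le ?_ (hK.isSum_replicate a hr hru n)
    rw [Multiset.replicate_le_replicate]
    exact Nat.lt_two_pow_self.le
  have h1 := hK.cover_le (ortho_mem hr) ((J_eq_zero_iff hr).1 h0)
  have h2 : K.cover z ≤ K.cover a := hru 0
  exact le_zero ((eq_zero_of_le_of_le_ortho hr le_rfl (h2.trans h1)) ▸ hK.le_cover z)

/-- Finite subsums of the differences of a decreasing sequence. -/
theorem exists_isSum_of_decreasing {f v : ℕ → E} (h : ∀ n, oplus (v (n + 1)) (f n) = some (v n))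
    (N : ℕ) {F : Finset ℕ} (hF : F ⊆ Finset.range N) :
    ∃ y z, IsSum (F.val.map f) y ∧ oplus y (v N) = some z ∧ z ≤ v 0 := by
  induction N generalizing F with
  | zero =>
    obtain rfl : F = ∅ := by simpa using hF
    exact ⟨0, v 0, IsSum.zero, zero_oplus _, le_rfl⟩
  | succ N ih =>
    -- The remainder `v N` splits into `v (N + 1)` and `f N`; the latter joins the sum or is
    -- dropped.
    by_cases hN : N ∈ F
    · obtain ⟨y, z, hy, hz, hz0⟩ := ih (F := F.erase N) (by grind)
      obtain ⟨t, ht, ht'⟩ := oplus_assoc_right (oplus_comm _ _ _ (h N)) hz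
      refine ⟨t, z, ?_, ht', hz0⟩
      rw [← Finset.insert_erase hN, Finset.insert_val_of_notMem (by simp), Multiset.map_cons]
      exact IsSum.cons _ _ _ _ hy (oplus_comm _ _ _ ht)
    · obtain ⟨y, z, hy, hz, hz0⟩ := ih (F := F) (by grind)
      obtain ⟨t, ht, ht'⟩ := exists_oplus_mono hz le_rfl (le_left (h N))
      exact ⟨y, t, hy, ht, ht'.trans hz0⟩

theorem exists_isSum_range {f v : ℕ → E} (h : ∀ n, oplus (v (n + 1)) (f n) = some (v n))
    (N : ℕ) : ∃ y, IsSum ((Finset.range N).val.map f) y ∧ oplus y (v N) = some (v 0) := by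
  induction N with
  | zero => exact ⟨0, IsSum.zero, zero_oplus _⟩
  | succ N ih =>
    obtain ⟨y, hy, hz⟩ := ih
    obtain ⟨t, ht, ht'⟩ := oplus_assoc_right (oplus_comm _ _ _ (h N)) hz
    refine ⟨t, ?_, ht'⟩
    rw [Finset.range_add_one, Finset.insert_val_of_notMem (by simp), Multiset.map_cons]
    exact IsSum.cons _ _ _ _ hy (oplus_comm _ _ _ ht)

/-- In the archimedean case `a°` is the orthosum of the projections `u_{0…01}`. -/
theorem IsSpectral.isOrthosum_cover (hK : K.IsSpectral) (hE : IsArchimedean E) (a : E) :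
    IsOrthosum (fun n => K.u a (List.replicate n false ++ [true])) (K.cover a) := by
  have hv : ∀ n, oplus (K.u a (List.replicate (n + 1) false))
      (K.u a (List.replicate n false ++ [true])) = some (K.u a (List.replicate n false)) :=
    fun n => by
      rw [List.replicate_succ']
      exact (hK.isSplitting a _).oplus_eq
  have hF : ∀ F : Finset ℕ, ∃ N, F ⊆ Finset.range N := fun F => F.exists_nat_subset_range
  refine ⟨fun F => ?_, ?_, fun x hx => ?_⟩
  · obtain ⟨N, hN⟩ := hF F
    obtain ⟨y, -, hy, -⟩ := exists_isSum_of_decreasing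
      (v := fun n => K.u a (List.replicate n false)) hv N hN
    exact ⟨y, hy⟩
  · rintro y ⟨F, hy⟩
    obtain ⟨N, hN⟩ := hF F
    obtain ⟨y', z, hy', hz, hz'⟩ :=
      exists_isSum_of_decreasing (v := fun n => K.u a (List.replicate n false)) hv N hN
    rw [hy.unique hy']
    exact (le_left hz).trans hz'
  · have hP := hK.cover_mem a
    -- For the partial sum `y` up to `N`, `J_{a°}(x') ≤ J_{a°}(y') = a° ⊖ y = u_{0…0}`, with `N`
    -- zeros.
    have h0 : K.J (K.cover a) (ortho x) = 0 := by
      refine hK.eq_zero_of_le_u hE a fun N => ?_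
      obtain ⟨y, hy, hyN⟩ :=
        exists_isSum_range (v := fun n => K.u a (List.replicate n false)) hv N
      change oplus y _ = some (K.cover a) at hyN
      have hle := J_mono hP (ortho_antitone (hx ⟨_, hy⟩))
      refine hle.trans ?_
      have h1 := J_additive hP _ _ _ (oplus_ortho y)
      rw [K.focus _ hP, J_eq_self hP (le_left hyN)] at h1
      exact (oplus_left_cancel h1 hyN).le
    have := le_ortho_comm ((J_eq_zero_iff hP).1 h0)
    rwa [ortho_ortho] at this

theorem IsSpectral.map_cover_eq_zero_iff (hK : K.IsSpectral) (hE : IsArchimedean E) (a : E)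
    {s : E → ℝ} (hs : IsState s) (hσ : IsSigmaAdditive s) :
    s a = 0 ↔ s (K.cover a) = 0 := by
  constructor
  · intro h
    have h1 := hσ _ _ (hK.isOrthosum_cover hE a)
    have h2 : ∀ n, s (K.u a (List.replicate n false ++ [true])) = 0 := fun n =>
      (hK.map_eq_zero_iff a hs).1 h _ (lam_append_true_pos _).ne'
    simp only [h2] at h1
    exact h1.unique hasSum_zero
  · intro h
    exact le_antisymm (h ▸ hs.mono (hK.le_cover a)) (hs.nonneg a)

end Archimedean

/-! ### Recovering the values on `u_w` from the spectral projections. -/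

section SpectralProjections

variable {s : E → ℝ}

/-- Since `u_w = u_{w0} ⊕ u_{w1}`, sums below the two children can be added. This guarantees that
the `msum` in `specProj` is a genuine sum, not the default value. -/
theorem IsSpectral.exists_isSum_filter (hK : K.IsSpectral) (a : E) (n : ℕ)
    (q : List Bool → Prop) [DecidablePred q] (w : List Bool) :
    ∃ x ≤ K.u a w, IsSum (((binStrings n).filter q).val.map fun v => K.u a (w ++ v)) x := by
  induction n generalizing q w with
  | zero =>
    rw [binStrings_zero, Finset.filter_singleton]
    split_ifs
    · exact ⟨K.u a w, le_rfl, by simpa using IsSum.singleton (K.u a w)⟩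
    · exact ⟨0, zero_le' _, by simpa using IsSum.zero⟩
  | succ n ih =>
    obtain ⟨x, hx, hx'⟩ := ih (fun v => q (false :: v)) (w ++ [false])
    obtain ⟨y, hy, hy'⟩ := ih (fun v => q (true :: v)) (w ++ [true])
    obtain ⟨z, hz, hz'⟩ := exists_oplus_mono (hK.isSplitting a w).oplus_eq hx hy
    refine ⟨z, hz', ?_⟩
    rw [filter_binStrings_succ, Multiset.map_add, Multiset.map_map, Multiset.map_map]
    simp only [List.append_assoc, List.singleton_append] at hx' hy'
    exact hx'.add hy' hz

open Classical in
theorem IsSpectral.map_specProj (hK : K.IsSpectral) (a : E) (hs : IsState s) (w : List Bool) :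
    s (K.specProj a (lam (w ++ [true]))) = 1 - s (K.cover a) +
      ∑ v ∈ (binStrings (w.length + 1)).filter (fun v => v ≤ w ++ [false]), s (K.u a v) := by
  have hex : ∃ v, lam (w ++ [true]) = lam (v ++ [true]) := ⟨w, rfl⟩
  rw [specProj, if_neg (lam_append_true_pos w).ne', if_neg (lam_lt_one _).ne, dif_pos hex,
    ← lam_append_true_injective hex.choose_spec]
  obtain ⟨x, hx, hx'⟩ := hK.exists_isSum_filter a (w.length + 1) (fun v => v ≤ w ++ [false]) []
  obtain ⟨y, hy, -⟩ := exists_oplus_mono (oplus_comm _ _ _ (oplus_ortho (K.cover a))) le_rfl hx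
  have hsum := pick_spec ⟨y, IsSum.cons _ _ _ _ hx' hy⟩
  have := hs.map_isSum hsum
  rw [Multiset.map_cons, Multiset.sum_cons, Multiset.map_map, hs.map_ortho] at this
  exact this

open Classical in
-- For `v < w` both children occur and merge into `u_v`, while of the children of `w` only `u_{w0}`
-- occurs; so it is the only term from the new level.
theorem IsSpectral.map_specProj_eq (hK : K.IsSpectral) (a : E) (hs : IsState s) (w : List Bool) :
    s (K.specProj a (lam (w ++ [true]))) = 1 - s (K.cover a) +
      ∑ v ∈ (binStrings w.length).filter (fun v => v < w), s (K.u a v) +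
        s (K.u a (w ++ [false])) := by
  rw [hK.map_specProj a hs, add_assoc, Finset.sum_filter, sum_binStrings_succ, Finset.sum_filter,
    ← Finset.sum_ite_eq_of_mem (binStrings w.length) w (fun _ => s (K.u a (w ++ [false])))
      (mem_binStrings.2 rfl), ← Finset.sum_add_distrib]
  congr 1
  refine Finset.sum_congr rfl fun v hv => ?_
  have hlen := mem_binStrings.1 hv
  have hadd := hs.map_oplus _ _ _ (hK.isSplitting a v).oplus_eq
  simp only [append_le_append_false hlen]
  by_cases h1 : v < w
  · have h2 : w ≠ v := fun h => lt_irrefl v (by rwa [h] at h1)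
    simp [h1, h2, hadd]
  · by_cases h2 : v = w
    · subst h2
      simp
    · simp [h1, h2, Ne.symm h2]

theorem IsSpectral.map_u_eq (hK : K.IsSpectral) {a b : E} (hs : IsState s)
    (h : ∀ w : List Bool, K.specProj a (lam w) = K.specProj b (lam w)) (n : ℕ) (w : List Bool)
    (hw : w.length = n) : s (K.u a w) = s (K.u b w) := by
  classical
  have hcov : s (K.cover a) = s (K.cover b) := by
    have h0 := h []
    simp only [specProj, lam_nil, if_true] at h0
    have := congrArg s h0
    rw [hs.map_ortho, hs.map_ortho] at this
    linarith
  induction n generalizing w with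
  | zero =>
    obtain rfl := List.length_eq_zero_iff.1 hw
    exact hcov
  | succ n ih =>
    obtain ⟨v, i, rfl⟩ := (List.eq_nil_or_concat' w).resolve_left (by rintro rfl; simp at hw)
    have hv : v.length = n := by simpa using hw
    have h1 := hK.map_specProj_eq a hs v
    have h2 := hK.map_specProj_eq b hs v
    have h3 : ∑ x ∈ (binStrings v.length).filter (fun x => x < v), s (K.u a x) =
        ∑ x ∈ (binStrings v.length).filter (fun x => x < v), s (K.u b x) :=
      Finset.sum_congr rfl fun x hx =>
        ih x ((mem_binStrings.1 (Finset.mem_filter.1 hx).1).trans hv)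
    -- Equal projections at `λ(v1)` and equal values on the previous level leave only this term.
    have h4 : s (K.u a (v ++ [false])) = s (K.u b (v ++ [false])) := by
      rw [h] at h1
      linarith
    cases i
    · exact h4
    · have h5 := hs.map_oplus _ _ _ (hK.isSplitting a v).oplus_eq
      have h6 := hs.map_oplus _ _ _ (hK.isSplitting b v).oplus_eq
      linarith [ih v hv]

end SpectralProjections

end CompressionBase

end EffectAlgebra

theorem mainTheorem5 {E : Type*} [EffectAlgebra E] (K : EffectAlgebra.CompressionBase E)
    (hK : K.IsSpectral) (a : E) (s : E → ℝ) (hs : EffectAlgebra.IsState s) :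
    (Filter.Tendsto
        (fun n : ℕ => ∑ w ∈ EffectAlgebra.binStrings n,
          (EffectAlgebra.lam w : ℝ) * s (K.u a w))
        Filter.atTop (nhds (s a)) ∧
      (s a = 0 ↔ ∀ w : List Bool, EffectAlgebra.lam w ≠ 0 → s (K.u a w) = 0)) ∧
    (EffectAlgebra.IsArchimedean E → EffectAlgebra.IsSigmaAdditive s →
      (s a = 0 ↔ s (K.cover a) = 0)) ∧
    (∀ b : E, (∀ w : List Bool,
        K.specProj a (EffectAlgebra.lam w) = K.specProj b (EffectAlgebra.lam w)) →
      s a = s b) := by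
  refine ⟨⟨hK.tendsto_sum a hs, hK.map_eq_zero_iff a hs⟩,
    fun hE hσ => hK.map_cover_eq_zero_iff hE a hs hσ, fun b h => ?_⟩
  refine tendsto_nhds_unique (hK.tendsto_sum a hs) ?_
  simpa only [hK.map_u_eq hs h _ _ rfl] using hK.tendsto_sum b hs
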